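/- Let $X_1,X_2,\dots$ be independent and identically distributed real random variables on a probability space, with the law of a random variable $X$. Suppose that $X$ is symmetric about $0$ (that is, $X$ and $-X$ have the same law), that all its moments $\mu_k=E(X^k)$, $k\ge 0$, are finite, and that $\sigma>0$, where $\sigma^2=E(X^2)$. Put $S_n=X_1+\cdots+X_n$. For an integer $p\ge 0$ let $m_p=(p-1)!!=(p-1)(p-3)\cdots 1$ if $p$ is even (with $(-1)!!=1$) and $m_p=0$ if $p$ is odd. Then: 1. For all $n\ge 1$ and $p\ge 0$ the $p$th moment of $S_n/(\sigma\sqrt n)$ is finite, and $$E\left(\frac{S_n^p}{n^{p/2}\sigma^p}\right)=m_p+\beta_n(p),$$ where $\beta_n(p)=0$ for every odd $p$, $$\beta_n(2)=0,\qquad \beta_n(4)=\frac1n\left(\frac{\mu_4}{\sigma^4}-3\right),$$ $$\beta_n(6)=\frac1n\left(\frac{15\mu_4}{\sigma^4}-45\right)+\frac1{n^2}\left(\frac{\mu_6}{\sigma^6}-\frac{15\mu_4}{\sigma^4}+30\right),$$ and $\beta_n(p)\to 0$ as $n\to\infty$ for every $p\ge 0$. Consequently $E\big(S_n^p/(n^{p/2}\sigma^p)\big)\to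 m_p$ for every $p\ge 0$. 2. For every $p\ge 0$, $m_p$ is the $p$th moment of the standard normal law $N(0,1)$, and $N(0,1)$ is determined by its moments: every probability measure on $\mathbb{R}$ all of whose moments are finite and whose $p$th moment is $m_p$ for every $p\ge 0$ equals $N(0,1)$. 3. $S_n/(\sigma\sqrt n)$ converges in distribution to $N(0,1)$ as $n\to\infty$. -/

import Mathlib

open MeasureTheory ProbabilityTheory Filter Topology

/-- The value `m_p` of the `p`-th moment of the standard normal law: the double factorial
`(p - 1)!! = (p - 1)(p - 3)⋯1` for even `p` (with `(-1)!! = 1`, the value that the truncated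
subtraction gives for `p = 0`), and `0` for odd `p`. -/
noncomputable def stdNormalMoment (p : ℕ) : ℝ :=
  if Even p then (Nat.doubleFactorial (p - 1) : ℝ) else 0

/-- `S_n / (σ √n)`, where `S_n` is the sum of the first `n` terms of the sequence `X`. -/
noncomputable def normalizedSum {Ω : Type*} (X : ℕ → Ω → ℝ) (σ : ℝ) (n : ℕ) (ω : Ω) : ℝ :=
  (∑ i ∈ Finset.range n, X i ω) / (σ * √(n : ℝ))

/-!
The moments of a random variable `Y` are recorded in the formal power series
`momentSeries P Y = ∑ E(Y ^ p) X ^ p / p!`. By independence the series of `S_n` is `F ^ n`, where `F`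
is the series of one variable (`integrable_sum_pow_and_momentSeries_sum`), so the
moments of `S_n` are read off from the coefficients of `F ^ n`. As `F` is even, its powers are even, and the coefficients of degree
2, 4 and 6 are computed by induction on `n`. For the limit, comparing coefficients in
`(F ^ (n + 1))' = (n + 1) F ^ n F'` expresses the `(p + 1)`st coefficient through lower ones; after
division by `√n ^ (p + 1)` only the quadratic term of `F` survives, which gives the recursion
`m_{p+2} = (p + 1) m_p` (`PowerSeries.tendsto_coeff_pow_div_sqrt_pow`).

The same recursion for the moments of `N(0, 1)` is an integration by parts
(`integral_pow_add_two_gaussianReal`). The normal law is determined by its moments because it has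
exponential moments (`MeasureTheory.Measure.ext_of_moments_eq`): if `ν` has the same moments, then
integrating the series of `cosh (t x)` term by term, which is legitimate since its terms are
nonnegative, shows that `ν` has exponential moments as well. The two moment generating functions
are then analytic on the line with equal Taylor series at `0`, hence equal.

Convergence in distribution follows by applying the central limit theorem for standardized variables
to `X_i / σ`.
-/

open scoped PowerSeries

/-! ### The numbers `m_p` -/

lemma stdNormalMoment_of_odd {p : ℕ} (hp : Odd p) : stdNormalMoment p = 0 := by
  simp [stdNormalMoment, Nat.not_even_iff_odd.2 hp]

lemma stdNormalMoment_zero : stdNormalMoment 0 = 1 := by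
  simp [stdNormalMoment]

lemma stdNormalMoment_add_two (p : ℕ) :
    stdNormalMoment (p + 2) = (p + 1) * stdNormalMoment p := by
  by_cases hp : Even p
  · have h : Even (p + 2) := hp.add (by decide)
    rw [stdNormalMoment, stdNormalMoment, if_pos h, if_pos hp,
      show p + 2 - 1 = p + 1 by omega, Nat.doubleFactorial_add_one]
    push_cast
    ring
  · have h : ¬ Even (p + 2) := by simpa [Nat.even_add] using hp
    simp [stdNormalMoment, hp, h]

/-! ### Moments of the standard normal law -/

lemma integrable_pow_gaussianReal (p : ℕ) :
    Integrable (fun x : ℝ => x ^ p) (gaussianReal 0 1) :=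
  integrable_pow_of_mem_interior_integrableExpSet (X := id) (by simp) p

lemma integrable_pow_mul_gaussianPDFReal (p : ℕ) :
    Integrable (fun x : ℝ => x ^ p * gaussianPDFReal 0 1 x) := by
  have h := (integrable_rpow_mul_exp_neg_mul_sq (b := 1 / 2) (by norm_num) (s := p)
    (by have : (0 : ℝ) ≤ p := p.cast_nonneg
        linarith)).const_mul (√(2 * Real.pi))⁻¹
  refine h.congr (ae_of_all _ fun x => ?_)
  simp only [gaussianPDFReal, Real.rpow_natCast, NNReal.coe_one, mul_one, sub_zero]
  rw [show -x ^ 2 / 2 = -(1 / 2) * x ^ 2 by ring]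
  ring

lemma hasDerivAt_gaussianPDFReal (x : ℝ) :
    HasDerivAt (gaussianPDFReal 0 1) (-(x * gaussianPDFReal 0 1 x)) x := by
  have h : HasDerivAt (fun y : ℝ => -y ^ 2 / 2) (-x) x :=
    ((hasDerivAt_pow 2 x).fun_neg.div_const 2).congr_deriv (by push_cast; ring)
  have hφ : gaussianPDFReal 0 1 = fun y => (√(2 * Real.pi))⁻¹ * Real.exp (-y ^ 2 / 2) := by
    ext y
    simp [gaussianPDFReal]
  rw [hφ]
  exact (h.exp.const_mul (√(2 * Real.pi))⁻¹).congr_deriv (by ring)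

/-- Integration by parts against the Gaussian density `φ`, using `φ' = -x φ`. -/
lemma integral_pow_add_two_gaussianReal (p : ℕ) :
    ∫ x, x ^ (p + 2) ∂(gaussianReal 0 1) = (p + 1) * ∫ x, x ^ p ∂(gaussianReal 0 1) := by
  rw [integral_gaussianReal_eq_integral_smul one_ne_zero,
    integral_gaussianReal_eq_integral_smul one_ne_zero]
  have h := integral_mul_deriv_eq_deriv_mul_of_integrable
    (u := fun x : ℝ => x ^ (p + 1)) (u' := fun x => (p + 1) * x ^ p)
    (v := gaussianPDFReal 0 1) (v' := fun x => -(x * gaussianPDFReal 0 1 x))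
    (fun x _ => by simpa using hasDerivAt_pow (p + 1) x)
    (fun x _ => hasDerivAt_gaussianPDFReal x)
    ((integrable_pow_mul_gaussianPDFReal (p + 2)).neg.congr
      (ae_of_all _ fun x => by simp only [Pi.neg_apply, Pi.mul_apply]; ring))
    (((integrable_pow_mul_gaussianPDFReal p).const_mul (p + 1 : ℝ)).congr
      (ae_of_all _ fun x => by simp only [Pi.mul_apply]; ring))
    (integrable_pow_mul_gaussianPDFReal (p + 1))
  simp only [mul_neg, integral_neg, neg_inj, mul_assoc, integral_const_mul] at h
  simp only [smul_eq_mul, mul_comm (gaussianPDFReal 0 1 _)]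
  rw [← h]
  refine integral_congr_ae (ae_of_all _ fun x => ?_)
  simp only
  ring

lemma integral_pow_gaussianReal : ∀ p : ℕ,
    ∫ x, x ^ p ∂(gaussianReal 0 1) = stdNormalMoment p
  | 0 => by simp [stdNormalMoment_zero]
  | 1 => by simp [stdNormalMoment_of_odd odd_one]
  | p + 2 => by
    rw [integral_pow_add_two_gaussianReal, integral_pow_gaussianReal p, stdNormalMoment_add_two]

/-! ### Determinacy of the moment problem -/

/-- The integral of `cosh (t x)` is the sum of the even moments weighted by `t ^ (2 k) / (2 k)!`;
all terms are nonnegative, so no integrability of `cosh (t x)` is needed. -/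
lemma lintegral_cosh_eq_tsum_moments {μ : Measure ℝ}
    (hμ : ∀ p : ℕ, Integrable (fun x : ℝ => x ^ p) μ) (t : ℝ) :
    ∫⁻ x, ENNReal.ofReal (Real.cosh (t * x)) ∂μ =
      ∑' k : ℕ, ENNReal.ofReal (t ^ (2 * k) / (2 * k).factorial * ∫ x, x ^ (2 * k) ∂μ) := by
  have hnn (k : ℕ) (x : ℝ) : 0 ≤ (t * x) ^ (2 * k) / ((2 * k).factorial : ℝ) :=
    div_nonneg ((even_two_mul k).pow_nonneg _) (Nat.cast_nonneg _)
  have hcosh (x : ℝ) : ENNReal.ofReal (Real.cosh (t * x)) =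
      ∑' k : ℕ, ENNReal.ofReal ((t * x) ^ (2 * k) / (2 * k).factorial) := by
    rw [Real.cosh_eq_tsum, ENNReal.ofReal_tsum_of_nonneg (fun k => hnn k x)
      (Real.hasSum_cosh _).summable]
  simp_rw [hcosh]
  rw [lintegral_tsum (fun k => by fun_prop)]
  refine tsum_congr fun k => ?_
  have heq (x : ℝ) : (t * x) ^ (2 * k) / ((2 * k).factorial : ℝ) =
      t ^ (2 * k) / (2 * k).factorial * x ^ (2 * k) := by ring
  rw [← ofReal_integral_eq_lintegral_ofReal _ (ae_of_all _ (hnn k))]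
  · simp_rw [heq, integral_const_mul]
  · simp_rw [heq]
    exact (hμ _).const_mul _

/-- A probability measure with exponential moments of all orders is determined by its moments. The
even moments alone bound the exponential moments of the other measure, and then the two moment
generating functions are entire with the same Taylor series at `0`. -/
theorem MeasureTheory.Measure.ext_of_moments_eq {μ ν : Measure ℝ} [IsProbabilityMeasure μ]
    [IsProbabilityMeasure ν] (hν : ∀ t : ℝ, Integrable (fun x => Real.exp (t * x)) ν)
    (hμ : ∀ p : ℕ, Integrable (fun x : ℝ => x ^ p) μ)
    (h : ∀ p : ℕ, ∫ x, x ^ p ∂μ = ∫ x, x ^ p ∂ν) : μ = ν := by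
  have hνset : integrableExpSet id ν = Set.univ := Set.eq_univ_of_forall hν
  have hνp (p : ℕ) : Integrable (fun x : ℝ => x ^ p) ν :=
    integrable_pow_of_mem_interior_integrableExpSet (X := id) (by simp [hνset]) p
  have hμexp (t : ℝ) : Integrable (fun x => Real.exp (t * x)) μ := by
    have hcosh : Integrable (fun x => Real.cosh (t * x)) μ := by
      refine ⟨by fun_prop, ?_⟩
      rw [hasFiniteIntegral_iff_ofReal (ae_of_all _ fun x => (Real.cosh_pos _).le),
        lintegral_cosh_eq_tsum_moments hμ]
      simp_rw [h]
      rw [← lintegral_cosh_eq_tsum_moments hνp,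
        ← hasFiniteIntegral_iff_ofReal (ae_of_all _ fun x => (Real.cosh_pos _).le)]
      refine (((hν t).add (hν (-t))).div_const 2).2.congr (ae_of_all _ fun x => ?_)
      simp [Real.cosh_eq]
    refine (hcosh.const_mul 2).mono' (by fun_prop) (ae_of_all _ fun x => ?_)
    rw [Real.norm_eq_abs, Real.abs_exp, Real.cosh_eq]
    linarith [Real.exp_pos (-(t * x))]
  have hμset : integrableExpSet id μ = Set.univ := Set.eq_univ_of_forall hμexp
  have hmgf : mgf id μ = mgf id ν := by
    have h1 := hasFPowerSeriesAt_mgf (X := id) (μ := μ) (v := 0) (by simp [hμset])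
    have h2 := hasFPowerSeriesAt_mgf (X := id) (μ := ν) (v := 0) (by simp [hνset])
    simp only [id, zero_mul, Real.exp_zero, mul_one, h] at h1 h2
    have a1 := analyticOnNhd_mgf (X := id) (μ := μ)
    have a2 := analyticOnNhd_mgf (X := id) (μ := ν)
    rw [hμset, interior_univ] at a1
    rw [hνset, interior_univ] at a2
    refine a1.eq_of_eventuallyEq a2 (z₀ := 0) ?_
    have h3 := h1.sub h2
    rw [sub_self] at h3
    filter_upwards [h3.eventually_eq_zero] with x hx
    exact sub_eq_zero.1 hx
  refine Measure.ext_of_complexMGF_id_eq (funext fun z => ?_)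
  exact eqOn_complexMGF_of_mgf hmgf (by simp [hμset])

/-! ### Powers of formal power series -/

namespace PowerSeries

lemma coeff_zero_pow_of_coeff_zero {F : ℝ⟦X⟧} (h0 : coeff 0 F = 1) (n : ℕ) :
    coeff 0 (F ^ n) = 1 := by
  simp only [coeff_zero_eq_constantCoeff, map_pow] at h0 ⊢
  simp [h0]

/-- If `F` is an even power series, then so are its powers. -/
lemma coeff_pow_of_odd {F : ℝ⟦X⟧} (hF : ∀ p, Odd p → coeff p F = 0) (n : ℕ) {p : ℕ}
    (hp : Odd p) : coeff p (F ^ n) = 0 := by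
  have hr : rescale (-1 : ℝ) F = F := by
    ext q
    rw [coeff_rescale]
    rcases q.even_or_odd with hq | hq
    · simp [hq.neg_one_pow]
    · simp [hF q hq]
  have h := coeff_rescale (F ^ n) (-1 : ℝ) p
  rw [map_pow, hr, hp.neg_one_pow] at h
  linarith

/-- The coefficientwise form of `(F ^ (n + 1))' = (n + 1) F ^ n F'`. -/
lemma coeff_succ_pow_succ (F : ℝ⟦X⟧) (n p : ℕ) :
    coeff (p + 1) (F ^ (n + 1)) * (p + 1) =
      (n + 1) * ∑ ij ∈ Finset.HasAntidiagonal.antidiagonal p,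
        coeff ij.1 (F ^ n) * (coeff (ij.2 + 1) F * (ij.2 + 1)) := by
  have h := congrArg (coeff p) (derivative_pow F (n + 1))
  rw [coeff_derivative, Nat.add_sub_cancel, mul_assoc, ← map_natCast (C (R := ℝ)), coeff_C_mul,
    coeff_mul] at h
  simpa [coeff_derivative] using h

/-- If `F = 1 + σ² X² / 2 + ⋯`, then `F (X / √n) ^ n` converges coefficientwise to
`exp (σ² X² / 2)`. -/
theorem tendsto_coeff_pow_div_sqrt_pow {F : ℝ⟦X⟧} {σ : ℝ} (h0 : coeff 0 F = 1) (h1 : coeff 1 F = 0)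
    (h2 : coeff 2 F = σ ^ 2 / 2) (p : ℕ) :
    Tendsto (fun n : ℕ => coeff p (F ^ n) / √(n : ℝ) ^ p) atTop
      (𝓝 (σ ^ p * stdNormalMoment p / p.factorial)) := by
  set L : ℕ → ℝ := fun p => σ ^ p * stdNormalMoment p / p.factorial with hL
  have hsqrt : Tendsto (fun n : ℕ => √((n + 1 : ℕ) : ℝ)) atTop atTop :=
    Real.tendsto_sqrt_atTop.comp (tendsto_natCast_atTop_atTop.comp (tendsto_add_atTop_nat 1))
  have hratio : Tendsto (fun n : ℕ => √(n : ℝ) / √((n + 1 : ℕ) : ℝ)) atTop (𝓝 1) := by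
    have h := (tendsto_natCast_div_add_atTop (1 : ℝ)).sqrt
    rw [Real.sqrt_one] at h
    refine h.congr fun n => ?_
    rw [Real.sqrt_div (Nat.cast_nonneg n)]
    push_cast
    rfl
  induction p using Nat.strong_induction_on with
  | _ p ih =>
    rcases p with _ | p
    · simp [coeff_zero_pow_of_coeff_zero h0, stdNormalMoment_zero, -coeff_zero_eq_constantCoeff]
    -- Divided by `√(n + 1) ^ (p + 1)`, the `(i, j)` term of the recursion has order
    -- `√n ^ (1 - j)`: the term `j = 0` vanishes because `F` has no linear term, and
    -- among the others only `j = 1` survives.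
    have hterm : ∀ ij ∈ Finset.HasAntidiagonal.antidiagonal p, Tendsto (fun n : ℕ =>
        (coeff ij.1 (F ^ n) / √(n : ℝ) ^ ij.1) * (√(n : ℝ) / √((n + 1 : ℕ) : ℝ)) ^ ij.1 *
          (√((n + 1 : ℕ) : ℝ) * (√((n + 1 : ℕ) : ℝ))⁻¹ ^ ij.2 *
            (coeff (ij.2 + 1) F * (ij.2 + 1)))) atTop
        (𝓝 (if ij.2 = 1 then L ij.1 * σ ^ 2 else 0)) := by
      rintro ⟨i, j⟩ hij
      rw [Finset.HasAntidiagonal.mem_antidiagonal] at hij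
      simp only at hij ⊢
      have hi := (ih i (by omega)).mul (hratio.pow i)
      rw [one_pow, mul_one] at hi
      rcases j with _ | _ | j
      · simp [h1]
      · have heq (n : ℕ) : √((n + 1 : ℕ) : ℝ) * (√((n + 1 : ℕ) : ℝ))⁻¹ ^ (0 + 1) = 1 := by
          have : √((n + 1 : ℕ) : ℝ) ≠ 0 := (Real.sqrt_pos.2 (by positivity)).ne'
          rw [zero_add, pow_one, mul_inv_cancel₀ this]
        simp_rw [heq]
        have := hi.mul_const (1 * (coeff (0 + 1 + 1) F * (((0 + 1 : ℕ) : ℝ) + 1)))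
        convert this using 2
        simp [h2, hL]
        left
        ring
      · have heq (n : ℕ) : √((n + 1 : ℕ) : ℝ) * (√((n + 1 : ℕ) : ℝ))⁻¹ ^ (j + 1 + 1) =
            (√((n + 1 : ℕ) : ℝ))⁻¹ ^ (j + 1) := by
          have : √((n + 1 : ℕ) : ℝ) ≠ 0 := (Real.sqrt_pos.2 (by positivity)).ne'
          rw [pow_succ' _ (j + 1), ← mul_assoc, mul_inv_cancel₀ this, one_mul]
        simp_rw [heq]
        have hz := ((tendsto_inv_atTop_zero.comp hsqrt).pow (j + 1)).mul_const
          (coeff (j + 1 + 1 + 1) F * (((j + 1 + 1 : ℕ) : ℝ) + 1))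
        simpa using hi.mul hz
    have hsum := (tendsto_finsetSum _ hterm).div_const ((p : ℝ) + 1)
    rw [← tendsto_add_atTop_iff_nat 1]
    have hlim : (∑ ij ∈ Finset.HasAntidiagonal.antidiagonal p,
        if ij.2 = 1 then L ij.1 * σ ^ 2 else 0) / ((p : ℝ) + 1) = L (p + 1) := by
      rcases p with _ | q
      · simp [hL, stdNormalMoment_of_odd odd_one]
      · rw [Finset.sum_eq_single (q, 1)]
        · have : ((q : ℝ) + 1 + 1) ≠ 0 := by positivity
          simp only [hL, if_true, stdNormalMoment_add_two, Nat.factorial_succ]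
          push_cast
          field_simp
          ring
        · rintro ⟨i, j⟩ hij hne
          rw [Finset.HasAntidiagonal.mem_antidiagonal] at hij
          refine if_neg fun hj => hne ?_
          simp only at hij hj
          ext <;> simp only <;> omega
        · intro hq
          simp [Finset.HasAntidiagonal.mem_antidiagonal] at hq
    rw [hlim] at hsum
    refine hsum.congr' ?_
    -- The factors `√n ^ i` introduced in `hterm` cancel only for `n ≠ 0`.
    filter_upwards [eventually_ge_atTop 1] with n hn
    have hp1 : (p : ℝ) + 1 ≠ 0 := by positivity
    have hrn : √(n : ℝ) ≠ 0 := (Real.sqrt_pos.2 (by exact_mod_cast hn)).ne'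
    have hr : √((n + 1 : ℕ) : ℝ) ≠ 0 := (Real.sqrt_pos.2 (by positivity)).ne'
    have hr2 : √((n + 1 : ℕ) : ℝ) ^ 2 = n + 1 := by
      rw [Real.sq_sqrt (by positivity)]
      push_cast
      rfl
    rw [div_eq_div_iff hp1 (pow_ne_zero _ hr), coeff_succ_pow_succ,
      Finset.mul_sum, Finset.sum_mul]
    refine Finset.sum_congr rfl fun ij hij => ?_
    rw [Finset.HasAntidiagonal.mem_antidiagonal] at hij
    rw [← hr2, ← hij, div_pow, inv_pow, pow_succ _ (ij.1 + ij.2), pow_add]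
    field_simp

lemma coeff_two_pow {F : ℝ⟦X⟧} (h0 : coeff 0 F = 1) (hF : ∀ p, Odd p → coeff p F = 0) (n : ℕ) :
    coeff 2 (F ^ n) = n * coeff 2 F := by
  induction n with
  | zero => simp [coeff_one]
  | succ n ih =>
    rw [pow_succ, coeff_mul]
    simp only [Finset.Nat.sum_antidiagonal_eq_sum_range_succ_mk, Finset.sum_range_succ,
      Finset.sum_range_zero, Nat.reduceSub, Nat.reduceAdd, Nat.succ_eq_add_one, zero_add,
      coeff_zero_pow_of_coeff_zero h0, h0, hF 1 (by decide), ih]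
    push_cast
    ring

lemma coeff_four_pow {F : ℝ⟦X⟧} (h0 : coeff 0 F = 1) (hF : ∀ p, Odd p → coeff p F = 0) (n : ℕ) :
    coeff 4 (F ^ n) = n * coeff 4 F + n * (n - 1) / 2 * coeff 2 F ^ 2 := by
  induction n with
  | zero => simp [coeff_one]
  | succ n ih =>
    rw [pow_succ, coeff_mul]
    simp only [Finset.Nat.sum_antidiagonal_eq_sum_range_succ_mk, Finset.sum_range_succ,
      Finset.sum_range_zero, Nat.reduceSub, Nat.reduceAdd, Nat.succ_eq_add_one, zero_add,
      coeff_zero_pow_of_coeff_zero h0, h0, hF 1 (by decide),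
      hF 3 (by decide), ih, coeff_two_pow h0 hF]
    push_cast
    ring

lemma coeff_six_pow {F : ℝ⟦X⟧} (h0 : coeff 0 F = 1) (hF : ∀ p, Odd p → coeff p F = 0) (n : ℕ) :
    coeff 6 (F ^ n) = n * coeff 6 F + n * (n - 1) * coeff 4 F * coeff 2 F +
      n * (n - 1) * (n - 2) / 6 * coeff 2 F ^ 3 := by
  induction n with
  | zero => simp [coeff_one]
  | succ n ih =>
    rw [pow_succ, coeff_mul]
    simp only [Finset.Nat.sum_antidiagonal_eq_sum_range_succ_mk, Finset.sum_range_succ,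
      Finset.sum_range_zero, Nat.reduceSub, Nat.reduceAdd, Nat.succ_eq_add_one, zero_add,
      coeff_zero_pow_of_coeff_zero h0, h0, hF 1 (by decide),
      hF 3 (by decide), hF 5 (by decide), ih, coeff_two_pow h0 hF, coeff_four_pow h0 hF]
    push_cast
    ring

end PowerSeries

/-! ### Moment series of independent sums -/

/-- The exponential generating function `∑ E(Y ^ p) X ^ p / p!` of the moments of `Y`, as a formal
power series. -/
noncomputable def momentSeries {Ω : Type*} [MeasurableSpace Ω] (P : Measure Ω) (Y : Ω → ℝ) :
    ℝ⟦X⟧ :=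
  PowerSeries.mk fun p => (∫ ω, Y ω ^ p ∂P) / p.factorial

section MomentSeries

variable {Ω : Type*} [MeasurableSpace Ω] {P : Measure Ω} {Y Z : Ω → ℝ}

lemma coeff_momentSeries (p : ℕ) :
    PowerSeries.coeff p (momentSeries P Y) = (∫ ω, Y ω ^ p ∂P) / p.factorial :=
  PowerSeries.coeff_mk _ _

lemma integral_pow_eq_coeff_momentSeries (p : ℕ) :
    ∫ ω, Y ω ^ p ∂P = p.factorial * PowerSeries.coeff p (momentSeries P Y) := by
  rw [coeff_momentSeries]
  field_simp

lemma ProbabilityTheory.IndepFun.integrable_pow_mul_pow (hYZ : IndepFun Y Z P)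
    (hY : ∀ p : ℕ, Integrable (fun ω => Y ω ^ p) P)
    (hZ : ∀ p : ℕ, Integrable (fun ω => Z ω ^ p) P) (i j : ℕ) :
    Integrable (fun ω => Y ω ^ i * Z ω ^ j) P :=
  IndepFun.integrable_mul
    (hYZ.comp (φ := fun x => x ^ i) (ψ := fun x => x ^ j) (by fun_prop) (by fun_prop)) (hY i) (hZ j)

lemma ProbabilityTheory.IndepFun.integrable_add_pow (hYZ : IndepFun Y Z P)
    (hY : ∀ p : ℕ, Integrable (fun ω => Y ω ^ p) P)
    (hZ : ∀ p : ℕ, Integrable (fun ω => Z ω ^ p) P) (p : ℕ) :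
    Integrable (fun ω => (Y ω + Z ω) ^ p) P := by
  simp_rw [add_pow]
  exact integrable_finsetSum _ fun k _ => (hYZ.integrable_pow_mul_pow hY hZ _ _).mul_const _

/-- By the binomial theorem, the moment series of a sum of independent variables is the product of
their moment series. -/
lemma ProbabilityTheory.IndepFun.momentSeries_add (hYZ : IndepFun Y Z P)
    (hY : ∀ p : ℕ, Integrable (fun ω => Y ω ^ p) P)
    (hZ : ∀ p : ℕ, Integrable (fun ω => Z ω ^ p) P) :
    momentSeries P (fun ω => Y ω + Z ω) = momentSeries P Y * momentSeries P Z := by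
  ext p
  rw [coeff_momentSeries, PowerSeries.coeff_mul]
  have hbinom (ω : Ω) := (Commute.all (Y ω) (Z ω)).add_pow' p
  simp_rw [nsmul_eq_mul] at hbinom
  simp_rw [hbinom]
  rw [integral_finsetSum _ fun k _ => (hYZ.integrable_pow_mul_pow hY hZ _ _).const_mul _,
    Finset.sum_div]
  refine Finset.sum_congr rfl fun k hk => ?_
  have hmul : ∫ ω, Y ω ^ k.1 * Z ω ^ k.2 ∂P = (∫ ω, Y ω ^ k.1 ∂P) * ∫ ω, Z ω ^ k.2 ∂P :=
    IndepFun.integral_fun_mul_eq_mul_integral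
      (hYZ.comp (φ := fun x => x ^ k.1) (ψ := fun x => x ^ k.2) (by fun_prop) (by fun_prop))
      (hY k.1).aestronglyMeasurable (hZ k.2).aestronglyMeasurable
  rw [Finset.HasAntidiagonal.mem_antidiagonal] at hk
  rw [integral_const_mul, hmul, coeff_momentSeries, coeff_momentSeries, ← hk,
    Nat.cast_add_choose]
  field_simp

lemma momentSeries_congr (h : IdentDistrib Y Z P P) : momentSeries P Y = momentSeries P Z := by
  ext p
  have := (h.comp (u := fun x => x ^ p) (by fun_prop)).integral_eq
  simp only [Function.comp_def] at this
  rw [coeff_momentSeries, coeff_momentSeries, this]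

/-- The odd coefficients of the moment series of a symmetric variable vanish. -/
lemma coeff_momentSeries_of_odd (h : IdentDistrib Y (fun ω => -Y ω) P P) {p : ℕ} (hp : Odd p) :
    PowerSeries.coeff p (momentSeries P Y) = 0 := by
  have := (h.comp (u := fun x => x ^ p) (by fun_prop)).integral_eq
  simp only [Function.comp_def, hp.neg_pow, integral_neg] at this
  rw [coeff_momentSeries, show ∫ ω, Y ω ^ p ∂P = 0 by linarith, zero_div]

/-- The partial sums of an i.i.d. sequence with finite moments have finite moments, and their moment
series are the powers of the moment series of one term. Both facts are proved in one induction, since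
multiplicativity of the moment series needs the integrability. -/
lemma integrable_sum_pow_and_momentSeries_sum [IsProbabilityMeasure P] {X : ℕ → Ω → ℝ}
    (hindep : iIndepFun X P)
    (hident : ∀ i : ℕ, IdentDistrib (X i) (X 0) P P)
    (hmom : ∀ p : ℕ, Integrable (fun ω => X 0 ω ^ p) P) (n : ℕ) :
    (∀ p : ℕ, Integrable (fun ω => (∑ i ∈ Finset.range n, X i ω) ^ p) P) ∧
      momentSeries P (fun ω => ∑ i ∈ Finset.range n, X i ω) = momentSeries P (X 0) ^ n := by
  induction n with
  | zero =>
    refine ⟨fun p => by simp, ?_⟩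
    ext p
    rcases p with _ | p
    · simp [coeff_momentSeries]
    · simp [coeff_momentSeries, PowerSeries.coeff_one]
  | succ n ih =>
    have hn (p : ℕ) : Integrable (fun ω => X n ω ^ p) P :=
      ((hident n).comp (u := fun x => x ^ p) (by fun_prop)).integrable_iff.2 (hmom p)
    have hi : IndepFun (fun ω => ∑ i ∈ Finset.range n, X i ω) (X n) P := by
      convert hindep.indepFun_sum_range_succ₀ (fun i => (hident i).aemeasurable_fst) n using 1
      ext ω
      simp
    simp_rw [Finset.sum_range_succ]
    exact ⟨hi.integrable_add_pow ih.1 hn, by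
      rw [hi.momentSeries_add ih.1 hn, ih.2, momentSeries_congr (hident n), pow_succ]⟩

end MomentSeries

/-! ### Normalized sums -/

section NormalizedSum

variable {Ω : Type*} [MeasurableSpace Ω] {P : Measure Ω} [IsProbabilityMeasure P]
  {X : ℕ → Ω → ℝ}

lemma integrable_normalizedSum_pow (hindep : iIndepFun X P)
    (hident : ∀ i : ℕ, IdentDistrib (X i) (X 0) P P)
    (hmom : ∀ p : ℕ, Integrable (fun ω => X 0 ω ^ p) P) (σ : ℝ) (n p : ℕ) :
    Integrable (fun ω => normalizedSum X σ n ω ^ p) P := by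
  simp_rw [normalizedSum, div_pow]
  exact ((integrable_sum_pow_and_momentSeries_sum hindep hident hmom n).1 p).div_const _

lemma integral_normalizedSum_pow (hindep : iIndepFun X P)
    (hident : ∀ i : ℕ, IdentDistrib (X i) (X 0) P P)
    (hmom : ∀ p : ℕ, Integrable (fun ω => X 0 ω ^ p) P) (σ : ℝ) (n p : ℕ) :
    ∫ ω, normalizedSum X σ n ω ^ p ∂P =
      p.factorial * PowerSeries.coeff p (momentSeries P (X 0) ^ n) / (σ * √(n : ℝ)) ^ p := by
  simp_rw [normalizedSum, div_pow]
  rw [integral_div, integral_pow_eq_coeff_momentSeries,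
    (integrable_sum_pow_and_momentSeries_sum hindep hident hmom n).2]

/-- The central limit theorem for variables of mean zero and variance `σ ^ 2`, from the standardized
case. -/
lemma tendstoInDistribution_normalizedSum (hindep : iIndepFun X P)
    (hident : ∀ i : ℕ, IdentDistrib (X i) (X 0) P P) (h0 : ∫ ω, X 0 ω ∂P = 0) {σ : ℝ}
    (hσ : σ ≠ 0) (hσ2 : σ ^ 2 = ∫ ω, X 0 ω ^ 2 ∂P) :
    TendstoInDistribution (fun n : ℕ => normalizedSum X σ n) atTop (id : ℝ → ℝ)
      (fun _ => P) (gaussianReal 0 1) := by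
  have h := tendstoInDistribution_inv_sqrt_mul_sum (P := P) (P' := gaussianReal 0 1)
    (X := fun i ω => X i ω / σ) (Y := (id : ℝ → ℝ)) HasLaw.id
    (by rw [integral_div, h0, zero_div])
    (by
      simp only [Pi.pow_apply, div_pow]
      rw [integral_div, ← hσ2, div_self (pow_ne_zero 2 hσ)])
    (hindep.comp (fun _ x => x / σ) (fun _ => by fun_prop))
    (fun i => (hident i).comp (u := fun x => x / σ) (by fun_prop))
  refine h.congr (fun n => ae_of_all _ fun ω => ?_) (ae_of_all _ fun _ => rfl)
  simp only [normalizedSum]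
  rw [← Finset.sum_div, mul_comm, ← div_eq_mul_inv, div_div]

end NormalizedSum

theorem mainTheorem2 {Ω : Type*} [MeasurableSpace Ω] (P : Measure Ω) [IsProbabilityMeasure P]
    (X : ℕ → Ω → ℝ)
    (hindep : iIndepFun X P)
    (hident : ∀ i : ℕ, IdentDistrib (X i) (X 0) P P)
    (hsymm : IdentDistrib (X 0) (fun ω => -X 0 ω) P P)
    (hmom : ∀ p : ℕ, Integrable (fun ω => X 0 ω ^ p) P)
    (σ : ℝ) (hσ : 0 < σ) (hσ2 : σ ^ 2 = ∫ ω, X 0 ω ^ 2 ∂P) :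
    -- the moments of the normalized sums, with their correction terms `β n p`
    (∃ β : ℕ → ℕ → ℝ,
      (∀ n : ℕ, 1 ≤ n → ∀ p : ℕ,
        Integrable (fun ω => normalizedSum X σ n ω ^ p) P ∧
        ∫ ω, normalizedSum X σ n ω ^ p ∂P = stdNormalMoment p + β n p) ∧
      (∀ n : ℕ, 1 ≤ n → ∀ p : ℕ, Odd p → β n p = 0) ∧
      (∀ n : ℕ, 1 ≤ n → β n 2 = 0) ∧
      (∀ n : ℕ, 1 ≤ n →
        β n 4 = 1 / (n : ℝ) * ((∫ ω, X 0 ω ^ 4 ∂P) / σ ^ 4 - 3)) ∧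
      (∀ n : ℕ, 1 ≤ n →
        β n 6 = 1 / (n : ℝ) * (15 * (∫ ω, X 0 ω ^ 4 ∂P) / σ ^ 4 - 45)
          + 1 / (n : ℝ) ^ 2 * ((∫ ω, X 0 ω ^ 6 ∂P) / σ ^ 6
              - 15 * (∫ ω, X 0 ω ^ 4 ∂P) / σ ^ 4 + 30)) ∧
      (∀ p : ℕ, Tendsto (fun n : ℕ => β n p) atTop (𝓝 0))) ∧
    -- hence the moments converge
    (∀ p : ℕ, Tendsto (fun n : ℕ => ∫ ω, normalizedSum X σ n ω ^ p ∂P) atTop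
      (𝓝 (stdNormalMoment p))) ∧
    -- the limits are the moments of the standard normal law
    (∀ p : ℕ, Integrable (fun x : ℝ => x ^ p) (gaussianReal 0 1) ∧
      ∫ x, x ^ p ∂(gaussianReal 0 1) = stdNormalMoment p) ∧
    -- the standard normal law is determined by its moments
    (∀ ν : Measure ℝ, IsProbabilityMeasure ν →
      (∀ p : ℕ, Integrable (fun x : ℝ => x ^ p) ν ∧ ∫ x, x ^ p ∂ν = stdNormalMoment p) →
      ν = gaussianReal 0 1) ∧
    -- the central limit theorem
    TendstoInDistribution (fun n : ℕ => normalizedSum X σ n) atTop (id : ℝ → ℝ)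
      (fun _ => P) (gaussianReal 0 1) := by
  set F := momentSeries P (X 0) with hF
  have hint := integrable_normalizedSum_pow hindep hident hmom σ
  have hval := integral_normalizedSum_pow hindep hident hmom σ
  have hodd : ∀ p, Odd p → PowerSeries.coeff p F = 0 := fun p hp =>
    coeff_momentSeries_of_odd hsymm hp
  have h0 : PowerSeries.coeff 0 F = 1 := by simp [hF, coeff_momentSeries]
  have h2 : PowerSeries.coeff 2 F = σ ^ 2 / 2 := by
    rw [hσ2, hF, coeff_momentSeries]
    norm_num
  have h4 : PowerSeries.coeff 4 F = (∫ ω, X 0 ω ^ 4 ∂P) / 24 := by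
    rw [hF, coeff_momentSeries]
    norm_num [Nat.factorial]
  have h6 : PowerSeries.coeff 6 F = (∫ ω, X 0 ω ^ 6 ∂P) / 720 := by
    rw [hF, coeff_momentSeries]
    norm_num [Nat.factorial]
  have hm2 : stdNormalMoment 2 = 1 := by
    rw [stdNormalMoment_add_two, stdNormalMoment_zero]
    norm_num
  have hm4 : stdNormalMoment 4 = 3 := by
    rw [stdNormalMoment_add_two, hm2]
    norm_num
  have hm6 : stdNormalMoment 6 = 15 := by
    rw [stdNormalMoment_add_two, hm4]
    norm_num
  have hσ0 : σ ≠ 0 := hσ.ne'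
  have hsq (n : ℕ) : √(n : ℝ) ^ 2 = n := Real.sq_sqrt n.cast_nonneg
  have hsq4 (n : ℕ) : √(n : ℝ) ^ 4 = n ^ 2 := by rw [← hsq n, ← pow_mul, hsq]
  have hsq6 (n : ℕ) : √(n : ℝ) ^ 6 = n ^ 3 := by rw [← hsq n, ← pow_mul, hsq]
  have hlim (p : ℕ) : Tendsto (fun n : ℕ => ∫ ω, normalizedSum X σ n ω ^ p ∂P) atTop
      (𝓝 (stdNormalMoment p)) := by
    have h := (PowerSeries.tendsto_coeff_pow_div_sqrt_pow h0 (hodd 1 odd_one) h2 p).const_mul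
      ((p.factorial : ℝ) / σ ^ p)
    have hp : (p.factorial : ℝ) ≠ 0 := by positivity
    convert h using 1
    · ext n
      rw [hval, mul_pow, mul_div_mul_comm]
    · congr 1
      field_simp
  refine ⟨⟨fun n p => (∫ ω, normalizedSum X σ n ω ^ p ∂P) - stdNormalMoment p,
    fun n _ p => ⟨hint n p, by ring⟩, ?_, ?_, ?_, ?_, ?_⟩, hlim, ?_, ?_, ?_⟩
  · intro n _ p hp
    beta_reduce
    rw [hval, PowerSeries.coeff_pow_of_odd hodd n hp, stdNormalMoment_of_odd hp]
    simp
  · intro n hn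
    have hn0 : (n : ℝ) ≠ 0 := by positivity
    beta_reduce
    rw [hval, PowerSeries.coeff_two_pow h0 hodd, h2, hm2, mul_pow, hsq]
    simp only [Nat.factorial]
    push_cast
    field_simp
    ring
  · intro n hn
    have hn0 : (n : ℝ) ≠ 0 := by positivity
    beta_reduce
    rw [hval, PowerSeries.coeff_four_pow h0 hodd, h2, h4, hm4, mul_pow, hsq4]
    simp only [Nat.factorial]
    push_cast
    field_simp
    ring
  · intro n hn
    have hn0 : (n : ℝ) ≠ 0 := by positivity
    beta_reduce
    rw [hval, PowerSeries.coeff_six_pow h0 hodd, h2, h4, h6, hm6, mul_pow, hsq6]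
    simp only [Nat.factorial]
    push_cast
    field_simp
    ring
  · intro p
    simpa using (hlim p).sub_const (stdNormalMoment p)
  · exact fun p => ⟨integrable_pow_gaussianReal p, integral_pow_gaussianReal p⟩
  · intro ν hν hνmom
    exact Measure.ext_of_moments_eq integrable_exp_mul_gaussianReal (fun p => (hνmom p).1)
      fun p => by rw [(hνmom p).2, integral_pow_gaussianReal]
  · refine tendstoInDistribution_normalizedSum hindep hident ?_ hσ0 hσ2
    have h := hodd 1 odd_one
    rw [hF, coeff_momentSeries] at h
    simpa using h
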